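/- Let $n\ge 0$, let $A\in\mathbb R^{n\times n}$ have $n$ real eigenvalues satisfying $0<\lambda_1<\lambda_2<\dots<\lambda_n<1$, and let $B\in\mathbb R^{n}$. Define the zonotopes $$E_n(P_N)=\Big\{\sum_{k=0}^{N-1}c_kA^kB:\ c_k\in[0,1]\Big\},\qquad E_n(P_\infty)=\Big\{\sum_{k=0}^{\infty}c_kA^kB:\ c_k\in[0,1]\Big\},$$ and put $$V_\infty=\sum_{0\le k_1<k_2<\dots<k_n}\det\big[\lambda_i^{k_j}\big]_{i,j=1}^n,\qquad \Phi=\prod_{1\le i<j\le n}\frac{\lambda_j-\lambda_i}{1-\lambda_i\lambda_j}\ \prod_{i=1}^n\frac1{1-\lambda_i}.$$ Then the series $V_\infty$ converges (unconditionally) and $$V_\infty=\Phi .$$ There is an invertible matrix $W\in\mathbb R^{n\times n}$ with $WAW^{-1}=\operatorname{diag}(\lambda_1,\dots,\lambda_n)$, and for every such $W$, with $WB=(\beta_1,\dots,\beta_n)^T$, the $n$-dimensional volume satisfies $$\operatorname{vol}_n\big(E_n(P_\infty)\big)=\lim_{N\to\infty}\operatorname{vol}_n\big(E_n(P_N)\big)=|\det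 W|^{-1}\,\Big|\prod_{i=1}^n\beta_i\Big|\;\Phi .$$ Consequently these values can be computed in time $O(1)$ with respect to $N$: there is an absolute constant $C$ such that, for every $n$, fixed arithmetic programs (operations $+,-,\times,/,|\cdot|$, constant $1$, no division by zero) using at most $Cn^2$ arithmetic operations compute $V_\infty$ from $\lambda_1,\dots,\lambda_n$, and $\operatorname{vol}_n(E_n(P_\infty))$ for the pair $A=\operatorname{diag}(\lambda_1,\dots,\lambda_n)$, $B=(\beta_1,\dots,\beta_n)^T$ from $\lambda_1,\dots,\lambda_n,\beta_1,\dots,\beta_n$, for all $0<\lambda_1<\dots<\lambda_n<1$ and all real $\beta_i$. -/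

import Mathlib

open MeasureTheory Filter Topology

noncomputable section

/-- The `k`-th column `A ^ k B` of the controllability matrix `[B, AB, A²B, …]` of a
single-input pair `(A, B)`. -/
def ctrlCol {n : ℕ} (A : Matrix (Fin n) (Fin n) ℝ) (B : Fin n → ℝ) (k : ℕ) : Fin n → ℝ :=
  (A ^ k).mulVec B

/-- The finite-time zonotope `E_n(P_N)`, generated by the columns of
`P_N = [B, AB, …, A ^ (N - 1) B]` with coefficients in `[0, 1]`. -/
def finiteZonotope {n : ℕ} (A : Matrix (Fin n) (Fin n) ℝ) (B : Fin n → ℝ) (N : ℕ) :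
    Set (Fin n → ℝ) :=
  {x | ∃ c : Fin N → ℝ, (∀ k, c k ∈ Set.Icc (0 : ℝ) 1) ∧
    x = ∑ k : Fin N, c k • ctrlCol A B k}

/-- The infinite-time zonotope `E_n(P_∞)`, generated by all the columns `A ^ k B`, `k ≥ 0`,
with coefficients in `[0, 1]`. -/
def infiniteZonotope {n : ℕ} (A : Matrix (Fin n) (Fin n) ℝ) (B : Fin n → ℝ) :
    Set (Fin n → ℝ) :=
  {x | ∃ c : ℕ → ℝ, (∀ k, c k ∈ Set.Icc (0 : ℝ) 1) ∧
    HasSum (fun k => c k • ctrlCol A B k) x}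

/-- The quasi-Vandermonde determinant `det [lam i ^ k j]`. -/
def quasiVandermonde {n : ℕ} (lam : Fin n → ℝ) (k : Fin n → ℕ) : ℝ :=
  (Matrix.of fun i j : Fin n => lam i ^ k j).det

/-- `V_∞`: the sum of the quasi-Vandermonde determinants over all exponent tuples
`0 ≤ k_1 < … < k_n` (the strictly increasing maps `Fin n ↪o ℕ`). -/
def infiniteDetSum {n : ℕ} (lam : Fin n → ℝ) : ℝ :=
  ∑' k : Fin n ↪o ℕ, quasiVandermonde lam k

/-- The closed form `Φ`. -/
def closedForm {n : ℕ} (lam : Fin n → ℝ) : ℝ :=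
  (∏ i : Fin n, ∏ j ∈ Finset.Ioi i, (lam j - lam i) / (1 - lam i * lam j)) *
    ∏ i : Fin n, 1 / (1 - lam i)

/-- Straight-line arithmetic programs, written as arithmetic expressions: the inputs are indexed
by `ι`, the only constant is `1`, and the operations are `+`, `-`, `*`, `/` and `|·|`. -/
inductive ArithExpr (ι : Type) : Type
  | input (i : ι) : ArithExpr ι
  | one : ArithExpr ι
  | add (a b : ArithExpr ι) : ArithExpr ι
  | sub (a b : ArithExpr ι) : ArithExpr ι
  | mul (a b : ArithExpr ι) : ArithExpr ι
  | div (a b : ArithExpr ι) : ArithExpr ι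
  | abs (a : ArithExpr ι) : ArithExpr ι

/-- `Evaluates x e v t`: on the real inputs `x`, the program `e` runs without dividing by zero,
returns `v`, and performs exactly `t` arithmetic operations. -/
inductive Evaluates {ι : Type} (x : ι → ℝ) : ArithExpr ι → ℝ → ℕ → Prop
  | input (i : ι) : Evaluates x (ArithExpr.input i) (x i) 0
  | one : Evaluates x ArithExpr.one 1 0
  | add {a b : ArithExpr ι} {u v : ℝ} {s t : ℕ} (ha : Evaluates x a u s)
      (hb : Evaluates x b v t) : Evaluates x (ArithExpr.add a b) (u + v) (s + t + 1)
  | sub {a b : ArithExpr ι} {u v : ℝ} {s t : ℕ} (ha : Evaluates x a u s)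
      (hb : Evaluates x b v t) : Evaluates x (ArithExpr.sub a b) (u - v) (s + t + 1)
  | mul {a b : ArithExpr ι} {u v : ℝ} {s t : ℕ} (ha : Evaluates x a u s)
      (hb : Evaluates x b v t) : Evaluates x (ArithExpr.mul a b) (u * v) (s + t + 1)
  | div {a b : ArithExpr ι} {u v : ℝ} {s t : ℕ} (ha : Evaluates x a u s)
      (hb : Evaluates x b v t) (hv : v ≠ 0) :
      Evaluates x (ArithExpr.div a b) (u / v) (s + t + 1)
  | abs {a : ArithExpr ι} {u : ℝ} {s : ℕ} (ha : Evaluates x a u s) :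
      Evaluates x (ArithExpr.abs a) |u| (s + 1)

end

/-!
Both halves of the result rest on one decomposition: a strictly increasing tuple of natural numbers
either starts with `0` or consists of positive numbers (`tsum_orderEmbedding_succ`).

*The determinant sum.* Expanding the determinants of the tuples that start with `0` along their
first column, and factoring the nodes out of the others, gives
`(1 - ∏ λ_i) V_∞(λ) = ∑ i, ± (∏_{l ≠ i} λ_l) V_∞(λ without λ_i)` (`infiniteDetSum_recursion`).
The closed form obeys the same recursion (`closedForm_recursion`). After division by `Φ` this says
that the polynomial `((∏ (1 - λ_l z)) - ∏ (λ_l - z)) / (1 + z)`, which has degree less than the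
number of nodes, is recovered at `z = 0` by Lagrange interpolation at the nodes
(`sum_lagrange_at_zero`).

*The volume.* The volume of a zonotope is the sum of the absolute values of the maximal minors of
its generators (`volume_segmentSum`). Indeed, after a linear change of coordinates the first
generator is a basis vector, and adding a unit segment to a convex body adds the volume of its
projection along that segment; the remaining zonotope and its projection correspond to the minors
without and with the first generator. The infinite zonotope lies between the increasing union of
the finite ones and its closure, and the frontier of a convex set is null
(`volume_infinite_eq_absMinorSum`).

*The link.* In eigencoordinates the minors of the controllability matrix are multiples of
quasi-Vandermonde determinants with one common factor. These are positive by Descartes' rule of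
signs (`quasiVandermonde_pos`), so the absolute values may be dropped and the sum of the minors is
a multiple of `V_∞`.

The closed form is a product of `n` factors, each a product of at most `n` quotients with four
operations, hence it is evaluated by a program of quadratic length.
-/

/-! ### Strictly increasing exponent tuples -/

/-- The strictly increasing tuple `(0, k 0 + 1, …, k (n - 1) + 1)`. -/
def consZeroShift {n : ℕ} (k : Fin n ↪o ℕ) : Fin (n + 1) ↪o ℕ :=
  OrderEmbedding.ofStrictMono (Fin.cons 0 fun j => k j + 1 : Fin (n + 1) → ℕ) <| by
    intro a b hab
    induction b using Fin.cases with
    | zero => exact absurd hab (Fin.not_lt_zero a)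
    | succ b =>
      induction a using Fin.cases with
      | zero => simp
      | succ a => simpa using hab

/-- The strictly increasing tuple `(k 0 + 1, …, k (n - 1) + 1)`. -/
def shiftOne {n : ℕ} (k : Fin n ↪o ℕ) : Fin n ↪o ℕ :=
  OrderEmbedding.ofStrictMono (fun j => k j + 1) fun a b hab => by simpa using hab

@[simp] lemma consZeroShift_zero {n : ℕ} (k : Fin n ↪o ℕ) : consZeroShift k 0 = 0 := rfl

@[simp] lemma consZeroShift_succ {n : ℕ} (k : Fin n ↪o ℕ) (j : Fin n) :
    consZeroShift k j.succ = k j + 1 := rfl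

@[simp] lemma shiftOne_apply {n : ℕ} (k : Fin n ↪o ℕ) (j : Fin n) : shiftOne k j = k j + 1 := rfl

/-- A strictly increasing tuple of positive length either starts with `0` or consists of positive
numbers only. -/
lemma bijective_consZeroShift_shiftOne (n : ℕ) :
    Function.Bijective (Sum.elim consZeroShift shiftOne :
      (Fin n ↪o ℕ) ⊕ (Fin (n + 1) ↪o ℕ) → (Fin (n + 1) ↪o ℕ)) := by
  constructor
  · rintro (k | k) (l | l) h
    · congr 1
      ext j
      simpa using DFunLike.congr_fun h j.succ
    · simpa using DFunLike.congr_fun h 0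
    · simpa using DFunLike.congr_fun h 0
    · congr 1
      ext j
      simpa using DFunLike.congr_fun h j
  · intro k
    by_cases h0 : k 0 = 0
    · have hpos : ∀ j : Fin n, 0 < k j.succ := fun j =>
        h0 ▸ k.strictMono (Fin.succ_pos j)
      refine ⟨Sum.inl (OrderEmbedding.ofStrictMono (fun j => k j.succ - 1) ?_), ?_⟩
      · intro a b hab
        have h1 := k.strictMono (Fin.succ_lt_succ_iff.2 hab)
        have h2 := hpos a
        have h3 := hpos b
        simp only
        omega
      · ext j
        induction j using Fin.cases with
        | zero => simp [h0]
        | succ j =>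
          have h2 := hpos j
          exact Nat.sub_add_cancel h2
    · have hpos : ∀ j, 0 < k j := fun j =>
        (Nat.pos_of_ne_zero h0).trans_le (k.monotone (Fin.zero_le j))
      refine ⟨Sum.inr (OrderEmbedding.ofStrictMono (fun j => k j - 1) ?_), ?_⟩
      · intro a b hab
        have h1 := k.strictMono hab
        have h2 := hpos a
        have h3 := hpos b
        simp only
        omega
      · ext j
        have h2 := hpos j
        exact Nat.sub_add_cancel h2

/-- Splitting a sum over strictly increasing tuples by whether the first entry is `0`. -/
lemma tsum_orderEmbedding_succ {α : Type*} [AddCommMonoid α] [TopologicalSpace α] [T2Space α]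
    [ContinuousAdd α] {n : ℕ} (f : (Fin (n + 1) ↪o ℕ) → α)
    (h₁ : Summable fun k => f (consZeroShift k)) (h₂ : Summable fun k => f (shiftOne k)) :
    ∑' k, f k = (∑' k, f (consZeroShift k)) + ∑' k, f (shiftOne k) := by
  rw [← (Equiv.ofBijective _ (bijective_consZeroShift_shiftOne n)).tsum_eq f]
  exact HasSum.tsum_eq (HasSum.sum h₁.hasSum h₂.hasSum)

/-! ### Summability of the quasi-Vandermonde determinants -/

lemma summable_prod_pow {n : ℕ} (a : Fin n → ℝ) (h0 : ∀ i, 0 ≤ a i) (h1 : ∀ i, a i < 1) :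
    Summable fun k : Fin n → ℕ => ∏ i, a i ^ k i := by
  induction n with
  | zero => exact (hasSum_fintype _).summable
  | succ n ih =>
    rw [← (Fin.consEquiv fun _ => ℕ).summable_iff]
    have h := (summable_geometric_of_lt_one (h0 0) (h1 0)).mul_of_nonneg
      (ih (fun i => a i.succ) (fun i => h0 _) fun i => h1 _)
      (fun k => pow_nonneg (h0 0) k)
      (fun k => Finset.prod_nonneg fun i _ => pow_nonneg (h0 _) _)
    refine h.congr fun k => ?_
    simp [Fin.prod_univ_succ]

/-- Each term of the Leibniz expansion is a product of geometric sequences. -/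
lemma summable_quasiVandermonde {n : ℕ} (lam : Fin n → ℝ) (h0 : ∀ i, 0 ≤ lam i)
    (h1 : ∀ i, lam i < 1) : Summable fun k : Fin n ↪o ℕ => quasiVandermonde lam k := by
  simp only [quasiVandermonde, Matrix.det_apply']
  refine summable_sum fun σ _ => Summable.mul_left _ ?_
  exact (summable_prod_pow (fun i => lam (σ i)) (fun i => h0 _) fun i => h1 _).comp_injective
    (i := fun k : Fin n ↪o ℕ => (k : Fin n → ℕ)) DFunLike.coe_injective

/-! ### The recursion for the determinant sum -/

lemma quasiVandermonde_shiftOne {n : ℕ} (lam : Fin n → ℝ) (k : Fin n ↪o ℕ) :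
    quasiVandermonde lam (shiftOne k) = (∏ i, lam i) * quasiVandermonde lam k := by
  rw [quasiVandermonde, quasiVandermonde, ← Matrix.det_mul_column]
  congr 1
  ext i j
  simp [pow_succ']

/-- Laplace expansion along the first column, which consists of ones. -/
lemma quasiVandermonde_consZeroShift {n : ℕ} (lam : Fin (n + 1) → ℝ) (k : Fin n ↪o ℕ) :
    quasiVandermonde lam (consZeroShift k) = ∑ i : Fin (n + 1),
      (-1) ^ (i : ℕ) * (∏ l, lam (i.succAbove l)) *
        quasiVandermonde (fun l => lam (i.succAbove l)) k := by
  rw [quasiVandermonde, Matrix.det_succ_column_zero]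
  refine Finset.sum_congr rfl fun i _ => ?_
  rw [mul_assoc ((-1 : ℝ) ^ (i : ℕ)) (∏ l, _), ← quasiVandermonde_shiftOne, quasiVandermonde]
  simp only [Matrix.of_apply, consZeroShift_zero, pow_zero, mul_one]
  rfl

lemma infiniteDetSum_recursion {n : ℕ} (lam : Fin (n + 1) → ℝ) (h0 : ∀ i, 0 ≤ lam i)
    (h1 : ∀ i, lam i < 1) :
    (1 - ∏ i, lam i) * infiniteDetSum lam = ∑ i : Fin (n + 1),
      (-1) ^ (i : ℕ) * (∏ l, lam (i.succAbove l)) *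
        infiniteDetSum fun l => lam (i.succAbove l) := by
  have hs := summable_quasiVandermonde lam h0 h1
  have hi : ∀ i : Fin (n + 1), Summable fun k : Fin n ↪o ℕ =>
      (-1) ^ (i : ℕ) * (∏ l, lam (i.succAbove l)) *
        quasiVandermonde (fun l => lam (i.succAbove l)) k := fun i =>
    (summable_quasiVandermonde _ (fun l => h0 _) fun l => h1 _).mul_left _
  have key : infiniteDetSum lam = (∑ i : Fin (n + 1),
      (-1) ^ (i : ℕ) * (∏ l, lam (i.succAbove l)) *
        infiniteDetSum fun l => lam (i.succAbove l)) + (∏ i, lam i) * infiniteDetSum lam := by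
    conv_lhs => rw [infiniteDetSum]
    rw [tsum_orderEmbedding_succ]
    · simp only [quasiVandermonde_consZeroShift, quasiVandermonde_shiftOne]
      rw [Summable.tsum_finsetSum fun i _ => hi i, tsum_mul_left]
      simp only [tsum_mul_left, infiniteDetSum]
    · simp only [quasiVandermonde_consZeroShift]
      exact summable_sum fun i _ => hi i
    · simp only [quasiVandermonde_shiftOne]
      exact hs.mul_left _
  linear_combination key

/-! ### The closed form -/

lemma univ_erase_eq_map_succAboveEmb {n : ℕ} (i : Fin (n + 1)) :
    Finset.univ.erase i = Finset.univ.map i.succAboveEmb := by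
  ext j
  simp [Fin.exists_succAbove_eq_iff]

lemma prod_univ_erase {M : Type*} [CommMonoid M] {n : ℕ} (i : Fin (n + 1)) (f : Fin (n + 1) → M) :
    ∏ j ∈ Finset.univ.erase i, f j = ∏ l, f (i.succAbove l) := by
  simp [univ_erase_eq_map_succAboveEmb]

/-- The product over all pairs `a < b`, with the pairs containing `i` separated. -/
lemma prod_pairs_succAbove {M : Type*} [CommMonoid M] {n : ℕ} (F : Fin (n + 1) → Fin (n + 1) → M)
    (i : Fin (n + 1)) :
    ∏ a, ∏ b ∈ Finset.Ioi a, F a b =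
      (∏ l : Fin n, if l.castSucc < i then F (i.succAbove l) i else F i (i.succAbove l)) *
        ∏ a, ∏ b ∈ Finset.Ioi a, F (i.succAbove a) (i.succAbove b) := by
  have h : ∀ (m : ℕ) (G : Fin m → Fin m → M),
      ∏ a, ∏ b ∈ Finset.Ioi a, G a b = ∏ a, ∏ b, if a < b then G a b else 1 := by
    intro m G
    refine Finset.prod_congr rfl fun a _ => ?_
    rw [← Finset.prod_filter]
    congr 1
    ext b
    simp
  rw [h, h n, Fin.prod_univ_succAbove _ i, Fin.prod_univ_succAbove _ i]
  simp only [Fin.prod_univ_succAbove _ i, Finset.prod_mul_distrib, lt_irrefl, if_false, one_mul,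
    ← mul_assoc, Fin.succAbove_lt_succAbove_iff]
  congr 1
  rw [← Finset.prod_mul_distrib]
  refine Finset.prod_congr rfl fun l _ => ?_
  by_cases hl : l.castSucc < i
  · have h1 : i.succAbove l < i := Fin.succAbove_lt_iff_castSucc_lt i l |>.2 hl
    simp [hl, h1, h1.not_gt]
  · have h1 : i < i.succAbove l := Fin.lt_succAbove_iff_le_castSucc i l |>.2 (not_lt.1 hl)
    simp [hl, h1, h1.not_gt]

/-- The factor of the closed form that involves the index `i`. -/
lemma closedForm_succAbove {n : ℕ} (lam : Fin (n + 1) → ℝ) (i : Fin (n + 1)) :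
    closedForm lam = (-1) ^ (i : ℕ) *
      (∏ l, (lam (i.succAbove l) - lam i) / (1 - lam i * lam (i.succAbove l))) *
        (1 / (1 - lam i)) * closedForm fun l => lam (i.succAbove l) := by
  have hsign : (∏ l : Fin n, if l.castSucc < i
        then (lam i - lam (i.succAbove l)) / (1 - lam (i.succAbove l) * lam i)
        else (lam (i.succAbove l) - lam i) / (1 - lam i * lam (i.succAbove l))) =
      (-1) ^ (i : ℕ) *
        ∏ l, (lam (i.succAbove l) - lam i) / (1 - lam i * lam (i.succAbove l)) := by
    have hc : (∏ l : Fin n, if l.castSucc < i then (-1 : ℝ) else 1) = (-1) ^ (i : ℕ) := by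
      rw [Finset.prod_ite]
      simp only [Finset.prod_const, one_pow, mul_one]
      congr 1
      simp only [Fin.lt_def, Fin.val_castSucc, Fin.card_filter_val_lt]
      omega
    rw [← hc, ← Finset.prod_mul_distrib]
    refine Finset.prod_congr rfl fun l _ => ?_
    split_ifs
    · rw [mul_comm (lam i), neg_one_mul, ← neg_div, neg_sub]
    · rw [one_mul]
  rw [closedForm, closedForm, prod_pairs_succAbove _ i, hsign, Fin.prod_univ_succAbove _ i]
  ring

open Polynomial in
/-- The value at `0` of the Lagrange interpolation polynomial with nodes `lam i` of the rational
function `∏ (1 - lam l * z) / (1 + z)`; the factor `l = i` of the numerator, evaluated at the node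
`lam i`, is `(1 - lam i) * (1 + lam i)`. -/
lemma sum_lagrange_at_zero {n : ℕ} (lam : Fin (n + 1) → ℝ) (hinj : Function.Injective lam)
    (h0 : ∀ i, 0 < lam i) :
    ∑ i, (1 - lam i) * ∏ l, lam (i.succAbove l) * (1 - lam i * lam (i.succAbove l)) /
      (lam (i.succAbove l) - lam i) = 1 - ∏ i, lam i := by
  -- Subtracting a multiple of the nodal polynomial makes the numerator vanish at `-1`.
  set P : ℝ[X] := ∏ l, (1 - C (lam l) * X) with hP
  set M : ℝ[X] := ∏ l, (X - C (lam l)) with hM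
  have hroot : IsRoot (P - C ((-1) ^ (n + 1)) * M) (-1 : ℝ) := by
    have : ∏ l, (-1 - lam l) = (-1) ^ (n + 1) * ∏ l, (1 + lam l) := by
      rw [show ((-1 : ℝ)) ^ (n + 1) = ∏ _l : Fin (n + 1), (-1 : ℝ) by simp,
        ← Finset.prod_mul_distrib]
      exact Finset.prod_congr rfl fun l _ => by ring
    simp only [IsRoot, hP, hM, eval_sub, eval_mul, eval_prod, eval_C, eval_X, eval_one, this]
    rw [← mul_assoc, ← mul_pow]
    simp
  obtain ⟨R, hR⟩ := dvd_iff_isRoot.2 hroot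
  have hRdeg : R.degree < (Finset.univ : Finset (Fin (n + 1))).card := by
    by_cases hR0 : R = 0
    · simp [hR0]
    have hle : (P - C ((-1) ^ (n + 1)) * M).natDegree ≤ n + 1 := by
      refine (natDegree_sub_le _ _).trans (max_le ?_ ?_)
      · refine (natDegree_prod_le _ _).trans ?_
        refine (Finset.sum_le_card_nsmul _ _ 1 fun l _ => ?_).trans (by simp)
        compute_degree
      · refine (natDegree_C_mul_le _ _).trans ?_
        refine (natDegree_prod_le _ _).trans ?_
        refine (Finset.sum_le_card_nsmul _ _ 1 fun l _ => ?_).trans (by simp)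
        compute_degree
    rw [hR, natDegree_mul (X_sub_C_ne_zero _) hR0, natDegree_X_sub_C] at hle
    rw [degree_eq_natDegree hR0, Finset.card_univ, Fintype.card_fin]
    exact_mod_cast (by omega : R.natDegree < n + 1)
  have hnode : ∀ i ∈ (Finset.univ : Finset (Fin (n + 1))), R.eval (lam i) =
      (1 - lam i) * ∏ l, (1 - lam i * lam (i.succAbove l)) := by
    intro i _
    have h := congrArg (eval (lam i)) hR
    have hMi : M.eval (lam i) = 0 := by
      rw [hM, eval_prod]
      exact Finset.prod_eq_zero (Finset.mem_univ i) (by simp)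
    have hPi : P.eval (lam i) = (1 - lam i * lam i) * ∏ l, (1 - lam i * lam (i.succAbove l)) := by
      rw [hP, eval_prod, Fin.prod_univ_succAbove _ i]
      simp only [eval_sub, eval_mul, eval_one, eval_C, eval_X, mul_comm (lam i)]
    simp only [eval_sub, eval_mul, hMi, hPi, eval_X, eval_C, mul_zero, sub_zero] at h
    have hne : lam i + 1 ≠ 0 := by have := h0 i; positivity
    apply mul_left_cancel₀ hne
    linear_combination -h
  have hint := Lagrange.eq_interpolate_of_eval_eq _ hinj.injOn hRdeg hnode
  have hR0 : R.eval 0 = 1 - ∏ i, lam i := by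
    have h := congrArg (eval 0) hR
    have hM0 : M.eval 0 = (-1) ^ (n + 1) * ∏ l, lam l := by
      rw [hM, eval_prod, show ((-1 : ℝ)) ^ (n + 1) = ∏ _l : Fin (n + 1), (-1 : ℝ) by simp,
        ← Finset.prod_mul_distrib]
      exact Finset.prod_congr rfl fun l _ => by simp
    have hP0 : P.eval 0 = 1 := by simp [hP, eval_prod]
    simp only [eval_sub, eval_mul, hM0, hP0, eval_X, eval_C] at h
    rw [← mul_assoc, ← mul_pow] at h
    simp at h
    exact h.symm
  rw [← hR0, hint, Lagrange.interpolate_apply, eval_finsetSum]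
  refine Finset.sum_congr rfl fun i _ => ?_
  rw [eval_mul, eval_C, Lagrange.basis, eval_prod, prod_univ_erase, mul_assoc,
    ← Finset.prod_mul_distrib]
  congr 1
  refine Finset.prod_congr rfl fun l _ => ?_
  have h1 : lam (i.succAbove l) - lam i ≠ 0 :=
    sub_ne_zero.2 fun h => Fin.succAbove_ne i l (hinj h)
  have h2 : lam i - lam (i.succAbove l) ≠ 0 := fun h => h1 (by linarith)
  simp only [Lagrange.basisDivisor, eval_mul, eval_C, eval_sub, eval_X]
  field_simp
  ring

/-- The closed form satisfies the recursion `infiniteDetSum_recursion`. -/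
lemma closedForm_recursion {n : ℕ} (lam : Fin (n + 1) → ℝ) (hinj : Function.Injective lam)
    (h0 : ∀ i, 0 < lam i) (h1 : ∀ i, lam i < 1) :
    (1 - ∏ i, lam i) * closedForm lam = ∑ i : Fin (n + 1),
      (-1) ^ (i : ℕ) * (∏ l, lam (i.succAbove l)) *
        closedForm fun l => lam (i.succAbove l) := by
  rw [← sum_lagrange_at_zero lam hinj h0, Finset.sum_mul]
  refine Finset.sum_congr rfl fun i _ => ?_
  rw [closedForm_succAbove lam i]
  have hi : 1 - lam i ≠ 0 := (sub_pos.2 (h1 i)).ne'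
  have hprod : (∏ l, lam (i.succAbove l) * (1 - lam i * lam (i.succAbove l)) /
      (lam (i.succAbove l) - lam i)) *
      (∏ l, (lam (i.succAbove l) - lam i) / (1 - lam i * lam (i.succAbove l))) =
      ∏ l, lam (i.succAbove l) := by
    rw [← Finset.prod_mul_distrib]
    refine Finset.prod_congr rfl fun l _ => ?_
    have h2 : lam (i.succAbove l) - lam i ≠ 0 :=
      sub_ne_zero.2 fun h => Fin.succAbove_ne i l (hinj h)
    have h3 : 1 - lam i * lam (i.succAbove l) ≠ 0 :=
      (sub_pos.2 (mul_lt_one_of_nonneg_of_lt_one_left (h0 _).le (h1 _) (h1 _).le)).ne'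
    rw [div_mul_div_comm, mul_assoc, mul_comm (1 - _) (_ - _), mul_div_assoc,
      div_self (mul_ne_zero h2 h3), mul_one]
  rw [← hprod]
  field_simp

/-- The two sides obey the same recursion on the number of nodes. -/
theorem infiniteDetSum_eq_closedForm {n : ℕ} (lam : Fin n → ℝ) (hinj : Function.Injective lam)
    (h0 : ∀ i, 0 < lam i) (h1 : ∀ i, lam i < 1) : infiniteDetSum lam = closedForm lam := by
  induction n with
  | zero =>
    have : Unique (Fin 0 ↪o ℕ) :=
      ⟨⟨OrderEmbedding.ofIsEmpty⟩, fun k => by ext j; exact j.elim0⟩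
    rw [infiniteDetSum, tsum_eq_single default fun k hk => absurd (Subsingleton.elim _ _) hk]
    simp [quasiVandermonde, closedForm]
  | succ n ih =>
    have hlt : ∏ i, lam i < 1 := by
      rw [Fin.prod_univ_succ]
      refine mul_lt_one_of_nonneg_of_lt_one_left (h0 0).le (h1 0) ?_
      exact Finset.prod_le_one (fun i _ => (h0 _).le) fun i _ => (h1 _).le
    apply mul_left_cancel₀ (sub_pos.2 hlt).ne'
    rw [infiniteDetSum_recursion lam (fun i => (h0 i).le) h1, closedForm_recursion lam hinj h0 h1]
    refine Finset.sum_congr rfl fun i _ => ?_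
    rw [ih (fun l => lam (i.succAbove l)) (hinj.comp Fin.succAbove_right_injective)
      (fun l => h0 _) fun l => h1 _]

/-! ### Positivity of the quasi-Vandermonde determinants -/

open Polynomial in
lemma signVariations_add_one_le_card_support (p : ℝ[X]) (hp : p ≠ 0) :
    signVariations p + 1 ≤ p.support.card := by
  induction h : p.support.card generalizing p with
  | zero => exact absurd (by simpa using h) hp
  | succ m ih =>
    by_cases he : p.eraseLead = 0
    · have : signVariations p = 0 := by
        rw [← eraseLead_add_monomial_natDegree_leadingCoeff p, he, zero_add,
          signVariations_monomial]
      omega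
    · have h1 := ih p.eraseLead he (card_support_eraseLead' h)
      have h2 := signVariations_le_eraseLead_succ (P := p)
      omega

open Polynomial in
/-- A consequence of Descartes' rule of signs: a real polynomial with at most `m` terms that
vanishes at `m` distinct positive points is zero. -/
lemma eq_zero_of_card_support_le_of_eval_eq_zero (p : ℝ[X]) (s : Finset ℝ)
    (hs : ∀ x ∈ s, 0 < x ∧ p.eval x = 0) (hcard : p.support.card ≤ s.card) : p = 0 := by
  by_contra hp
  have h1 := signVariations_add_one_le_card_support p hp
  have h2 := roots_countP_pos_le_signVariations (P := p)
  have h3 : s.val ≤ p.roots.filter (0 < ·) := by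
    rw [Multiset.le_iff_subset s.nodup]
    intro x hx
    have := hs x hx
    simp [hp, this.1, this.2]
  have h4 := Multiset.card_le_card h3
  rw [← Multiset.countP_eq_card_filter] at h4
  have h5 : s.card = s.val.card := rfl
  omega

/-- Generalized Vandermonde determinants with increasing positive nodes and increasing exponents
are positive. -/
theorem quasiVandermonde_pos {n : ℕ} (lam : Fin n → ℝ) (hmono : StrictMono lam)
    (h0 : ∀ i, 0 < lam i) (k : Fin n → ℕ) (hk : StrictMono k) : 0 < quasiVandermonde lam k := by
  induction n with
  | zero => simp [quasiVandermonde]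
  | succ n ih =>
    -- As a function of its last node, the determinant is a polynomial with `n + 1` terms and
    -- positive leading coefficient; it vanishes at the other `n` nodes, so it has no further
    -- positive zero and stays positive to the right of them.
    set c : Fin (n + 1) → ℝ := fun j => (-1) ^ (n + (j : ℕ)) *
      quasiVandermonde (fun i => lam i.castSucc) fun l => k (j.succAbove l) with hc
    set p : Polynomial ℝ := ∑ j, Polynomial.C (c j) * Polynomial.X ^ k j with hp
    have heval : ∀ x, p.eval x = (Matrix.of fun i j : Fin (n + 1) =>
        (Fin.snoc (fun i => lam i.castSucc) x : Fin (n + 1) → ℝ) i ^ k j).det := by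
      intro x
      rw [Matrix.det_succ_row _ (Fin.last n), hp, Polynomial.eval_finsetSum]
      refine Finset.sum_congr rfl fun j _ => ?_
      simp only [hc, quasiVandermonde, Polynomial.eval_mul, Polynomial.eval_C,
        Polynomial.eval_pow, Polynomial.eval_X, Matrix.of_apply, Fin.snoc_last, Fin.val_last]
      have : (Matrix.of fun i l : Fin n => lam i.castSucc ^ k (j.succAbove l)) =
          (Matrix.of fun i j : Fin (n + 1) =>
            (Fin.snoc (fun i => lam i.castSucc) x : Fin (n + 1) → ℝ) i ^ k j).submatrix
            (Fin.last n).succAbove j.succAbove := by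
        ext i l
        simp
      rw [this]
      ring
    have hlast : p.eval (lam (Fin.last n)) = quasiVandermonde lam k := by
      rw [heval, quasiVandermonde]
      congr 2
      ext i j
      congr 2
      induction i using Fin.lastCases <;> simp
    have hzero : ∀ i : Fin n, p.eval (lam i.castSucc) = 0 := by
      intro i
      rw [heval]
      refine Matrix.det_zero_of_row_eq (Fin.castSucc_lt_last i).ne ?_
      ext j
      simp
    have hcoeff : p.coeff (k (Fin.last n)) = c (Fin.last n) := by
      rw [hp, Polynomial.finsetSum_coeff, Finset.sum_eq_single (Fin.last n)]
      · simp
      · intro j _ hj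
        simp [Polynomial.coeff_X_pow, hk.injective.eq_iff, hj.symm]
      · simp
    have hcpos : 0 < c (Fin.last n) := by
      simp only [hc, Fin.val_last, Fin.succAbove_last]
      rw [Even.neg_one_pow ⟨n, rfl⟩, one_mul]
      exact ih _ (hmono.comp Fin.strictMono_castSucc) (fun i => h0 _) _
        (hk.comp Fin.strictMono_castSucc)
    have hp0 : p ≠ 0 := fun h => by simp [h] at hcoeff; exact hcpos.ne hcoeff
    have hdeg : p.natDegree ≤ k (Fin.last n) := by
      refine Polynomial.natDegree_sum_le_of_forall_le _ _ fun j _ => ?_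
      exact (Polynomial.natDegree_C_mul_X_pow_le _ _).trans (hk.monotone (Fin.le_last j))
    have hlead : p.leadingCoeff = c (Fin.last n) := by
      rw [← hcoeff, Polynomial.leadingCoeff,
        le_antisymm hdeg (Polynomial.le_natDegree_of_ne_zero (hcoeff ▸ hcpos.ne'))]
    have hsupp : p.support.card ≤ n + 1 := by
      have : p.support ⊆ Finset.univ.image k := by
        intro m hm
        by_contra hmk
        simp only [Finset.mem_image, Finset.mem_univ, true_and, not_exists] at hmk
        rw [Polynomial.mem_support_iff, hp, Polynomial.finsetSum_coeff] at hm
        refine hm (Finset.sum_eq_zero fun j _ => ?_)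
        simp [Polynomial.coeff_X_pow, (Ne.symm (hmk j))]
      exact (Finset.card_le_card this).trans (Finset.card_image_le.trans (by simp))
    have hne : ∀ x, (∀ i : Fin n, lam i.castSucc < x) → 0 < x → p.eval x ≠ 0 := by
      intro x hx hx0 hpx
      refine hp0 (eq_zero_of_card_support_le_of_eval_eq_zero p
        (insert x (Finset.univ.image fun i : Fin n => lam i.castSucc)) ?_ ?_)
      · intro y hy
        rw [Finset.mem_insert, Finset.mem_image] at hy
        rcases hy with rfl | ⟨i, -, rfl⟩
        · exact ⟨hx0, hpx⟩
        · exact ⟨h0 _, hzero i⟩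
      · rw [Finset.card_insert_of_notMem, Finset.card_image_of_injective]
        · simpa using hsupp
        · exact (hmono.comp Fin.strictMono_castSucc).injective
        · simp only [Finset.mem_image, Finset.mem_univ, true_and, not_exists]
          exact fun i => (hx i).ne
    have hL : ∀ i : Fin n, lam i.castSucc < lam (Fin.last n) := fun i =>
      hmono (Fin.castSucc_lt_last i)
    rw [← hlast]
    by_contra! hle
    have hlt : p.eval (lam (Fin.last n)) < 0 := lt_of_le_of_ne hle (hne _ hL (h0 _))
    have hev : ∃ y, lam (Fin.last n) ≤ y ∧ 0 ≤ p.eval y := by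
      by_cases hd : 0 < p.degree
      · have ht := p.tendsto_atTop_of_leadingCoeff_nonneg hd (hlead ▸ hcpos.le)
        obtain ⟨y, h1, h2⟩ := ((eventually_ge_atTop (lam (Fin.last n))).and
          (ht.eventually_ge_atTop 0)).exists
        exact ⟨y, h1, h2⟩
      · rw [Polynomial.eq_C_of_degree_le_zero (not_lt.1 hd), Polynomial.leadingCoeff_C] at hlead
        rw [Polynomial.eq_C_of_degree_le_zero (not_lt.1 hd), Polynomial.eval_C, hlead] at hlt
        exact absurd hlt hcpos.not_gt
    obtain ⟨y, hy, hpy⟩ := hev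
    obtain ⟨z, hz, hpz⟩ := intermediate_value_Icc hy p.continuous.continuousOn
      (⟨hlt.le, hpy⟩ : (0 : ℝ) ∈ Set.Icc _ _)
    exact hne z (fun i => (hL i).trans_le hz.1) ((h0 _).trans_le hz.1) hpz

/-! ### The volume of a zonotope -/

open scoped Pointwise in
/-- The zonotope `∑ k < N, [0, v k]`, as an iterated Minkowski sum of segments. -/
def segmentSum {n : ℕ} (v : ℕ → Fin n → ℝ) : ℕ → Set (Fin n → ℝ)
  | 0 => {0}
  | N + 1 => segment ℝ 0 (v 0) + segmentSum (fun k => v (k + 1)) N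

lemma segmentSum_eq {n : ℕ} (v : ℕ → Fin n → ℝ) (N : ℕ) :
    segmentSum v N = {x | ∃ c : Fin N → ℝ, (∀ k, c k ∈ Set.Icc (0 : ℝ) 1) ∧
      x = ∑ k : Fin N, c k • v k} := by
  induction N generalizing v with
  | zero =>
    ext x
    simp [segmentSum]
  | succ N ih =>
    ext x
    simp only [segmentSum, ih, Set.mem_add, segment_eq_image, Set.mem_image, Set.mem_ofPred_eq,
      smul_zero, zero_add]
    constructor
    · rintro ⟨_, ⟨t, ht, rfl⟩, _, ⟨c, hc, rfl⟩, rfl⟩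
      refine ⟨Fin.cons t c, Fin.cases ht hc, ?_⟩
      simp [Fin.sum_univ_succ]
    · rintro ⟨c, hc, rfl⟩
      refine ⟨_, ⟨c 0, hc 0, rfl⟩, _, ⟨fun k => c k.succ, fun k => hc _, rfl⟩, ?_⟩
      simp [Fin.sum_univ_succ]

lemma segmentSum_congr {n : ℕ} {v w : ℕ → Fin n → ℝ} {N : ℕ} (h : ∀ k < N, v k = w k) :
    segmentSum v N = segmentSum w N := by
  simp_rw [segmentSum_eq, fun k : Fin N => h k k.2]

lemma isCompact_segmentSum {n : ℕ} (v : ℕ → Fin n → ℝ) (N : ℕ) : IsCompact (segmentSum v N) := by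
  induction N generalizing v with
  | zero => exact isCompact_singleton
  | succ N ih =>
    refine IsCompact.add ?_ (ih _)
    rw [segment_eq_image]
    exact isCompact_Icc.image (by fun_prop)

lemma convex_segmentSum {n : ℕ} (v : ℕ → Fin n → ℝ) (N : ℕ) : Convex ℝ (segmentSum v N) := by
  induction N generalizing v with
  | zero => exact convex_singleton 0
  | succ N ih => exact (convex_segment _ _).add (ih _)

lemma image_segmentSum {n m : ℕ} (f : (Fin n → ℝ) →ₗ[ℝ] (Fin m → ℝ)) (v : ℕ → Fin n → ℝ)
    (N : ℕ) : f '' segmentSum v N = segmentSum (fun k => f (v k)) N := by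
  induction N generalizing v with
  | zero => simp [segmentSum]
  | succ N ih =>
    rw [segmentSum, segmentSum, Set.image_add, ih]
    congr 1
    have := image_segment ℝ f.toAffineMap 0 (v 0)
    simpa using this

lemma volume_eq_lintegral_fiber {n : ℕ} {S : Set (Fin (n + 1) → ℝ)} (hS : MeasurableSet S) :
    volume S = ∫⁻ y : Fin n → ℝ, volume {t : ℝ | (Fin.cons t y : Fin (n + 1) → ℝ) ∈ S} := by
  have h := (volume_preserving_piFinSuccAbove (fun _ : Fin (n + 1) => ℝ) 0).symm
  rw [← h.measure_preimage hS.nullMeasurableSet, Measure.volume_eq_prod, Measure.prod_apply_symm]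
  · simp [MeasurableEquiv.piFinSuccAbove, Fin.consEquiv, Set.preimage]
  · exact h.measurable hS

open scoped Pointwise in
lemma volume_Icc_add {F : Set ℝ} (hc : IsCompact F) (hconv : Convex ℝ F) (hne : F.Nonempty) :
    volume (Set.Icc (0 : ℝ) 1 + F) = volume F + 1 := by
  have hF := eq_Icc_of_connected_compact ⟨hne, hconv.isPreconnected⟩ hc
  have hle : sInf F ≤ sSup F := Real.sInf_le_sSup F hc.bddBelow hc.bddAbove
  rw [hF, Set.Icc_add_Icc zero_le_one hle, Real.volume_Icc, Real.volume_Icc,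
    ← ENNReal.ofReal_one, ← ENNReal.ofReal_add (sub_nonneg.2 hle) zero_le_one]
  congr 1
  ring

open scoped Pointwise in
/-- Adding the unit segment in the first coordinate direction to a convex body lengthens each
nonempty fibre in that direction by one. -/
lemma volume_segment_add {n : ℕ} {K : Set (Fin (n + 1) → ℝ)} (hc : IsCompact K)
    (hconv : Convex ℝ K) :
    volume (segment ℝ 0 (Pi.single 0 1) + K) =
      volume K + volume ((fun x : Fin (n + 1) → ℝ => fun j : Fin n => x j.succ) '' K) := by
  have hseg : IsCompact (segment ℝ 0 (Pi.single 0 1 : Fin (n + 1) → ℝ)) := by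
    rw [segment_eq_image]
    exact isCompact_Icc.image (by fun_prop)
  have htail : IsCompact ((fun x : Fin (n + 1) → ℝ => fun j : Fin n => x j.succ) '' K) :=
    hc.image (by fun_prop)
  rw [volume_eq_lintegral_fiber (hseg.add hc).measurableSet,
    volume_eq_lintegral_fiber hc.measurableSet, ← lintegral_indicator_one htail.measurableSet,
    ← lintegral_add_right _ (measurable_one.indicator htail.measurableSet)]
  congr 1
  ext y
  set F : Set ℝ := {t : ℝ | (Fin.cons t y : Fin (n + 1) → ℝ) ∈ K} with hF
  have hfib : {t : ℝ | (Fin.cons t y : Fin (n + 1) → ℝ) ∈ segment ℝ 0 (Pi.single 0 1) + K} =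
      Set.Icc (0 : ℝ) 1 + F := by
    ext t
    simp only [segment_eq_image, Set.mem_add, Set.mem_image, Set.mem_ofPred_eq, smul_zero, zero_add,
      hF]
    constructor
    · rintro ⟨_, ⟨s, hs, rfl⟩, x, hx, hxy⟩
      refine ⟨s, hs, x 0, ?_, ?_⟩
      · have : (Fin.cons (x 0) y : Fin (n + 1) → ℝ) = x := by
          ext j
          induction j using Fin.cases with
          | zero => simp
          | succ j => simpa using (congrFun hxy j.succ).symm
        rwa [this]
      · simpa using congrFun hxy 0
    · rintro ⟨s, hs, r, hr, rfl⟩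
      refine ⟨_, ⟨s, hs, rfl⟩, _, hr, ?_⟩
      ext j
      induction j using Fin.cases <;> simp
  rw [hfib]
  by_cases hne : F.Nonempty
  · have hmem : y ∈ (fun x : Fin (n + 1) → ℝ => fun j : Fin n => x j.succ) '' K := by
      obtain ⟨t, ht⟩ := hne
      exact ⟨_, ht, by ext j; simp⟩
    have hFc : IsCompact F := by
      have : F ⊆ (fun x : Fin (n + 1) → ℝ => x 0) '' K := fun t ht => ⟨_, ht, by simp⟩
      refine (hc.image (continuous_apply 0)).of_isClosed_subset ?_ this
      exact hc.isClosed.preimage (by fun_prop)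
    have hFconv : Convex ℝ F := by
      intro s hs t ht a b ha hb hab
      have := hconv hs ht ha hb hab
      rw [hF, Set.mem_ofPred_eq]
      convert this using 1
      ext j
      induction j using Fin.cases with
      | zero => simp
      | succ j => simp [← add_mul, hab]
    rw [volume_Icc_add hFc hFconv hne, Set.indicator_of_mem hmem, Pi.one_apply]
  · have hmem : y ∉ (fun x : Fin (n + 1) → ℝ => fun j : Fin n => x j.succ) '' K := by
      rintro ⟨x, hx, rfl⟩
      refine hne ⟨x 0, ?_⟩
      have : (Fin.cons (x 0) fun j => x j.succ : Fin (n + 1) → ℝ) = x := Fin.cons_self_tail x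
      rwa [hF, Set.mem_ofPred_eq, this]
    rw [Set.not_nonempty_iff_eq_empty.1 hne, Set.indicator_of_notMem hmem]
    simp

lemma det_map_rows {n : ℕ} (f : (Fin n → ℝ) →ₗ[ℝ] (Fin n → ℝ)) (v : Fin n → Fin n → ℝ) :
    (Matrix.of fun j => f (v j)).det = LinearMap.det f * (Matrix.of v).det := by
  have h := (Pi.basisFun ℝ (Fin n)).det_comp f v
  rwa [Pi.basisFun_det] at h

lemma det_of_single_row {n : ℕ} (M : Matrix (Fin (n + 1)) (Fin (n + 1)) ℝ)
    (h : M 0 = Pi.single 0 1) : M.det = (M.submatrix Fin.succ Fin.succ).det := by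
  rw [Matrix.det_succ_row_zero, Finset.sum_eq_single 0]
  · simp [h]
  · intro j _ hj
    simp [h, hj]
  · simp

/-- The sum of the absolute values of the maximal minors of the matrix with columns `v k`, as an
extended nonnegative real, so that no summability is needed. The vectors are placed as rows, which
does not change the determinants. -/
noncomputable def absMinorSum {n : ℕ} (v : ℕ → Fin n → ℝ) : ENNReal :=
  ∑' k : Fin n ↪o ℕ, ENNReal.ofReal |(Matrix.of fun j => v (k j)).det|

lemma absMinorSum_succ {n : ℕ} (v : ℕ → Fin (n + 1) → ℝ) :
    absMinorSum v = (∑' k : Fin n ↪o ℕ,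
        ENNReal.ofReal |(Matrix.of fun j => v (consZeroShift k j)).det|) +
      absMinorSum fun k => v (k + 1) := by
  rw [absMinorSum, tsum_orderEmbedding_succ _ ENNReal.summable ENNReal.summable]
  rfl

lemma volume_segmentSum_of_dim_zero (v : ℕ → Fin 0 → ℝ) (N : ℕ) :
    volume (segmentSum v N) = absMinorSum v := by
  have : Unique (Fin 0 ↪o ℕ) :=
    ⟨⟨OrderEmbedding.ofIsEmpty⟩, fun k => by ext j; exact j.elim0⟩
  rw [Subsingleton.eq_univ_of_nonempty (s := segmentSum v N), absMinorSum,
    tsum_eq_single default fun k hk => absurd (Subsingleton.elim _ _) hk]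
  · simp [volume_pi]
  · rw [segmentSum_eq]
    exact ⟨_, 0, by simp, rfl⟩

open scoped Pointwise in
/-- The volume of a zonotope is the sum of the volumes of the parallelepipeds spanned by its
generators. The proof removes the first generator: a linear change of coordinates turns it into a
basis vector, and `volume_segment_add` reduces to a smaller zonotope and to its projection. -/
theorem volume_segmentSum {n : ℕ} (v : ℕ → Fin n → ℝ) (N : ℕ) (hv : ∀ k, N ≤ k → v k = 0) :
    volume (segmentSum v N) = absMinorSum v := by
  induction N generalizing n v with
  | zero =>
    cases n with
    | zero => exact volume_segmentSum_of_dim_zero v 0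
    | succ n =>
      have h : ∀ k : Fin (n + 1) ↪o ℕ, (Matrix.of fun j => v (k j)).det = 0 := fun k =>
        Matrix.det_eq_zero_of_row_eq_zero 0 fun j => by simp [hv]
      simp [absMinorSum, h, segmentSum]
  | succ N ih =>
    have hv' : ∀ k, N ≤ k → v (k + 1) = 0 := fun k hk => hv _ (by omega)
    cases n with
    | zero => exact volume_segmentSum_of_dim_zero v (N + 1)
    | succ n =>
      rw [absMinorSum_succ, ← ih _ hv', segmentSum]
      by_cases h0 : v 0 = 0
      · have h : ∀ k : Fin n ↪o ℕ, (Matrix.of fun j => v (consZeroShift k j)).det = 0 := fun k =>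
          Matrix.det_eq_zero_of_row_eq_zero 0 fun j => by simp [h0]
        simp [h, h0]
      · have he : (Pi.single 0 1 : Fin (n + 1) → ℝ) ≠ 0 := by simp
        obtain ⟨f, hf⟩ := SeparatingDual.exists_continuousLinearEquiv_apply_eq (R := ℝ) h0 he
        set g : (Fin (n + 1) → ℝ) →ₗ[ℝ] (Fin (n + 1) → ℝ) :=
          f.toLinearEquiv.toLinearMap with hg
        have hgv : g (v 0) = Pi.single 0 1 := hf
        have hdet : LinearMap.det g ≠ 0 := f.toLinearEquiv.isUnit_det'.ne_zero
        set d := ENNReal.ofReal |LinearMap.det g| with hd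
        have hd0 : d ≠ 0 := by simpa [hd] using hdet
        have hvol := Measure.addHaar_image_linearMap (volume : Measure (Fin (n + 1) → ℝ)) g
        have himage : g '' (segment ℝ 0 (v 0) + segmentSum (fun k => v (k + 1)) N) =
            segment ℝ 0 (Pi.single 0 1) + segmentSum (fun k => g (v (k + 1))) N := by
          have := image_segmentSum g v (N + 1)
          rwa [segmentSum, segmentSum, hgv] at this
        have hproj := image_segmentSum (LinearMap.funLeft ℝ ℝ Fin.succ)
          (fun k => g (v (k + 1))) N
        have hminor : ∀ k : Fin n ↪o ℕ,
            ENNReal.ofReal |(Matrix.of fun j => LinearMap.funLeft ℝ ℝ Fin.succ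
              (g (v (k j + 1)))).det| =
            d * ENNReal.ofReal |(Matrix.of fun j => v (consZeroShift k j)).det| := by
          intro k
          rw [hd, ← ENNReal.ofReal_mul (abs_nonneg _), ← abs_mul, ← det_map_rows,
            det_of_single_row _ hgv]
          rfl
        rw [← ENNReal.mul_right_inj hd0 ENNReal.ofReal_ne_top, ← hvol, himage,
          volume_segment_add (isCompact_segmentSum _ _) (convex_segmentSum _ _), mul_add, add_comm,
          ← hvol, image_segmentSum g, ← ENNReal.tsum_mul_left]
        congr 1
        simp only [← hminor]
        refine (congrArg volume hproj).trans (ih _ fun k hk => ?_)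
        simp [hv' k hk]

/-! ### Infinitely many generators -/

/-- The zonotopes spanned by more and more generators: their volumes converge to the sum of all
absolute maximal minors. -/
theorem tendsto_volume_segmentSum {n : ℕ} (v : ℕ → Fin n → ℝ) :
    Tendsto (fun N => volume (segmentSum v N)) atTop (𝓝 (absMinorSum v)) := by
  have hfin : ∀ N : ℕ, {k : Fin n ↪o ℕ | ∀ j, k j < N}.Finite := fun N =>
    (Set.Finite.pi' fun _ : Fin n => Set.finite_Iio N).preimage
      (f := fun k : Fin n ↪o ℕ => (k : Fin n → ℕ)) DFunLike.coe_injective.injOn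
  have hmem : ∀ N (k : Fin n ↪o ℕ), k ∈ (hfin N).toFinset ↔ ∀ j, k j < N := fun N k => by simp
  -- The tuples with entries below `N` exhaust all finite sets of tuples, and truncating the
  -- generators at `N` kills exactly the other minors.
  have hlim : Tendsto (fun N => (hfin N).toFinset) atTop atTop := by
    refine tendsto_atTop_finset_of_monotone (fun N M hNM k hk => ?_) fun k => ?_
    · rw [hmem] at hk ⊢
      exact fun j => (hk j).trans_le hNM
    · refine ⟨∑ j, k j + 1, (hmem _ _).2 fun j => ?_⟩
      exact Nat.lt_succ_of_le (Finset.single_le_sum (f := fun j => k j) (fun i _ => Nat.zero_le _)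
        (Finset.mem_univ j))
  have hsum : HasSum (fun k : Fin n ↪o ℕ => ENNReal.ofReal |(Matrix.of fun j => v (k j)).det|)
      (absMinorSum v) := ENNReal.summable.hasSum
  refine (hsum.comp hlim).congr fun N => ?_
  rw [segmentSum_congr (w := fun k => if k < N then v k else 0) fun k hk => by simp [hk],
    volume_segmentSum _ N fun k hk => by simp [hk.not_gt], absMinorSum,
    tsum_eq_sum (s := (hfin N).toFinset)]
  · refine Finset.sum_congr rfl fun k hk => ?_
    rw [hmem] at hk
    simp [hk]
  · intro k hk
    rw [hmem, not_forall] at hk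
    obtain ⟨j, hj⟩ := hk
    rw [Matrix.det_eq_zero_of_row_eq_zero j fun i => by simp [hj]]
    simp

lemma segmentSum_mono {n : ℕ} (v : ℕ → Fin n → ℝ) : Monotone (segmentSum v) := by
  refine monotone_nat_of_le_succ fun N x hx => ?_
  rw [segmentSum_eq] at hx ⊢
  obtain ⟨c, hc, rfl⟩ := hx
  refine ⟨Fin.snoc c 0, fun k => ?_, ?_⟩
  · induction k using Fin.lastCases with
    | last => simp
    | cast k => simpa using hc k
  · simp [Fin.sum_univ_castSucc]

/-- The zonotope with infinitely many generators lies between the increasing union of the finite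
zonotopes and its closure; since the union is convex, they have the same volume. -/
theorem volume_infinite_eq_absMinorSum {n : ℕ} (v : ℕ → Fin n → ℝ) :
    volume {x | ∃ c : ℕ → ℝ, (∀ k, c k ∈ Set.Icc (0 : ℝ) 1) ∧ HasSum (fun k => c k • v k) x} =
      absMinorSum v := by
  set S := {x | ∃ c : ℕ → ℝ, (∀ k, c k ∈ Set.Icc (0 : ℝ) 1) ∧ HasSum (fun k => c k • v k) x}
  set U := ⋃ N, segmentSum v N with hU
  have hUvol : volume U = absMinorSum v :=
    tendsto_nhds_unique (tendsto_measure_iUnion_atTop (segmentSum_mono v))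
      (tendsto_volume_segmentSum v)
  have hconv : Convex ℝ U :=
    (segmentSum_mono v).directed_le.convex_iUnion fun N => convex_segmentSum v N
  have hUS : U ⊆ S := by
    refine Set.iUnion_subset fun N x hx => ?_
    rw [segmentSum_eq] at hx
    obtain ⟨c, hc, rfl⟩ := hx
    refine ⟨fun k => if h : k < N then c ⟨k, h⟩ else 0, fun k => ?_, ?_⟩
    · dsimp only
      split_ifs with h
      · exact hc _
      · simp
    · have := hasSum_sum_of_ne_finset_zero (s := Finset.range N)
        (f := fun k => (if h : k < N then c ⟨k, h⟩ else 0) • v k) (L := .unconditional ℕ)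
        fun k hk => by
          rw [Finset.mem_range] at hk
          simp [hk]
      convert this using 1
      rw [Finset.sum_range]
      simp
  have hSU : S ⊆ closure U := by
    rintro x ⟨c, hc, hx⟩
    refine mem_closure_of_tendsto hx.tendsto_sum_nat (Eventually.of_forall fun N => ?_)
    refine Set.mem_iUnion.2 ⟨N, ?_⟩
    rw [segmentSum_eq]
    exact ⟨fun k => c k, fun k => hc k, by rw [Finset.sum_range]⟩
  refine le_antisymm ?_ (hUvol ▸ measure_mono hUS)
  calc volume S ≤ volume (U ∪ frontier U) :=
        measure_mono (hSU.trans (closure_eq_self_union_frontier U).le)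
    _ ≤ volume U + volume (frontier U) := measure_union_le _ _
    _ = absMinorSum v := by rw [hconv.addHaar_frontier volume, add_zero, hUvol]

/-! ### The zonotopes of a controllability matrix -/

lemma conj_mulVec_ctrlCol {n : ℕ} {A W : Matrix (Fin n) (Fin n) ℝ} {lam : Fin n → ℝ}
    (B : Fin n → ℝ) (hW : IsUnit W.det) (hA : W * A * W⁻¹ = Matrix.diagonal lam) (k : ℕ)
    (i : Fin n) : W.mulVec (ctrlCol A B k) i = lam i ^ k * W.mulVec B i := by
  have hWA : W * A = Matrix.diagonal lam * W := by
    rw [← hA, Matrix.mul_assoc, Matrix.nonsing_inv_mul _ hW, Matrix.mul_one]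
  have hpow : W * A ^ k = Matrix.diagonal lam ^ k * W := by
    have h : SemiconjBy W A (Matrix.diagonal lam) := hWA
    exact (h.pow_right k)
  rw [ctrlCol, Matrix.mulVec_mulVec, hpow, Matrix.diagonal_pow, ← Matrix.mulVec_mulVec,
    Matrix.mulVec_diagonal]
  rfl

/-- In eigencoordinates the vectors `A ^ k B` have the entries `lam i ^ k * (W B) i`. -/
lemma det_ctrlCol {n : ℕ} {A W : Matrix (Fin n) (Fin n) ℝ} {lam : Fin n → ℝ}
    (B : Fin n → ℝ) (hW : IsUnit W.det) (hA : W * A * W⁻¹ = Matrix.diagonal lam)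
    (k : Fin n → ℕ) :
    W.det * (Matrix.of fun j => ctrlCol A B (k j)).det =
      (∏ i, W.mulVec B i) * quasiVandermonde lam k := by
  rw [← LinearMap.det_toLin' W, ← det_map_rows, quasiVandermonde, ← Matrix.det_mul_column,
    ← Matrix.det_transpose]
  congr 1
  ext i j
  simp [conj_mulVec_ctrlCol B hW hA, mul_comm]

lemma absMinorSum_ctrlCol {n : ℕ} {A W : Matrix (Fin n) (Fin n) ℝ} {lam : Fin n → ℝ}
    (hmono : StrictMono lam) (h0 : ∀ i, 0 < lam i) (h1 : ∀ i, lam i < 1)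
    (B : Fin n → ℝ) (hW : IsUnit W.det) (hA : W * A * W⁻¹ = Matrix.diagonal lam) :
    absMinorSum (ctrlCol A B) =
      ENNReal.ofReal (|W.det|⁻¹ * (|∏ i, (W.mulVec B) i| * closedForm lam)) := by
  have hpos : ∀ k : Fin n ↪o ℕ, 0 < quasiVandermonde lam k := fun k =>
    quasiVandermonde_pos lam hmono h0 k k.strictMono
  have hterm : ∀ k : Fin n ↪o ℕ, |(Matrix.of fun j => ctrlCol A B (k j)).det| =
      |W.det|⁻¹ * (|∏ i, (W.mulVec B) i| * quasiVandermonde lam k) := by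
    intro k
    rw [eq_inv_mul_iff_mul_eq₀ (abs_ne_zero.2 hW.ne_zero), ← abs_mul, det_ctrlCol B hW hA,
      abs_mul, abs_of_pos (hpos k)]
  have hsum := summable_quasiVandermonde lam (fun i => (h0 i).le) h1
  simp only [absMinorSum, hterm]
  rw [← ENNReal.ofReal_tsum_of_nonneg (fun k => by have := hpos k; positivity)
    ((hsum.mul_left _).mul_left _), tsum_mul_left, tsum_mul_left,
    ← infiniteDetSum_eq_closedForm lam hmono.injective h0 h1, infiniteDetSum]

lemma closedForm_nonneg {n : ℕ} {lam : Fin n → ℝ} (hmono : StrictMono lam)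
    (h0 : ∀ i, 0 < lam i) (h1 : ∀ i, lam i < 1) : 0 ≤ closedForm lam := by
  rw [← infiniteDetSum_eq_closedForm lam hmono.injective h0 h1]
  exact tsum_nonneg fun k => (quasiVandermonde_pos lam hmono h0 k k.strictMono).le

lemma finiteZonotope_eq_segmentSum {n : ℕ} (A : Matrix (Fin n) (Fin n) ℝ) (B : Fin n → ℝ)
    (N : ℕ) : finiteZonotope A B N = segmentSum (ctrlCol A B) N :=
  (segmentSum_eq _ N).symm

lemma volume_infiniteZonotope {n : ℕ} (A : Matrix (Fin n) (Fin n) ℝ) (B : Fin n → ℝ) :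
    volume (infiniteZonotope A B) = absMinorSum (ctrlCol A B) :=
  volume_infinite_eq_absMinorSum _

lemma exists_conj_eq_diagonal {n : ℕ} (A : Matrix (Fin n) (Fin n) ℝ) (lam : Fin n → ℝ)
    (heig : ∀ i, Module.End.HasEigenvalue (Matrix.toLin' A) (lam i))
    (hinj : Function.Injective lam) :
    ∃ W : Matrix (Fin n) (Fin n) ℝ, IsUnit W.det ∧ W * A * W⁻¹ = Matrix.diagonal lam := by
  choose v hv using fun i => (heig i).exists_hasEigenvector
  have hli := Module.End.eigenvectors_linearIndependent' (Matrix.toLin' A) lam hinj v hv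
  set Q : Matrix (Fin n) (Fin n) ℝ := (Matrix.of v).transpose with hQ
  have hQdet : IsUnit Q.det := by
    rw [hQ, Matrix.det_transpose, ← Matrix.isUnit_iff_isUnit_det]
    exact Matrix.linearIndependent_rows_iff_isUnit.1 hli
  have hAQ : A * Q = Q * Matrix.diagonal lam := by
    ext i j
    have := congrFun (hv j).apply_eq_smul i
    rw [Matrix.mul_diagonal]
    simpa [hQ, Matrix.mul_apply, Matrix.mulVec, dotProduct, mul_comm] using this
  refine ⟨Q⁻¹, Matrix.isUnit_nonsing_inv_det _ hQdet, ?_⟩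
  rw [Matrix.nonsing_inv_nonsing_inv _ hQdet, Matrix.mul_assoc, hAQ, ← Matrix.mul_assoc,
    Matrix.nonsing_inv_mul _ hQdet, Matrix.one_mul]

/-! ### Arithmetic programs -/

/-- Multiplying a family of programs; starting from the constant `1` costs one multiplication per
factor and none for the empty product. -/
lemma exists_program_prod {ι κ : Type} (s : Finset κ) (e : κ → ArithExpr ι) (c : ℕ) :
    ∃ E : ArithExpr ι, ∀ (x : ι → ℝ) (v : κ → ℝ),
      (∀ k ∈ s, ∃ t ≤ c, Evaluates x (e k) (v k) t) →
        ∃ t ≤ s.card * (c + 1), Evaluates x E (∏ k ∈ s, v k) t := by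
  classical
  induction s using Finset.induction_on with
  | empty => exact ⟨ArithExpr.one, fun x v _ => ⟨0, by simp, by simpa using Evaluates.one⟩⟩
  | insert a s ha ih =>
    obtain ⟨E, hE⟩ := ih
    refine ⟨ArithExpr.mul (e a) E, fun x v h => ?_⟩
    obtain ⟨t₁, ht₁, h₁⟩ := h a (Finset.mem_insert_self a s)
    obtain ⟨t₂, ht₂, h₂⟩ := hE x v fun k hk => h k (Finset.mem_insert_of_mem hk)
    refine ⟨t₁ + t₂ + 1, ?_, ?_⟩
    · rw [Finset.card_insert_of_notMem ha, add_mul]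
      omega
    · rw [Finset.prod_insert ha]
      exact Evaluates.mul h₁ h₂

/-- The part of the closed form that is attached to the smaller index `i` of a pair. -/
noncomputable def closedFormFactor {n : ℕ} (lam : Fin n → ℝ) (i : Fin n) : ℝ :=
  (∏ j ∈ Finset.Ioi i, (lam j - lam i) / (1 - lam i * lam j)) * (1 / (1 - lam i))

lemma closedForm_eq_prod_factor {n : ℕ} (lam : Fin n → ℝ) :
    closedForm lam = ∏ i, closedFormFactor lam i :=
  Finset.prod_mul_distrib.symm

lemma exists_program_closedFormFactor {ι : Type} {n : ℕ} (a : Fin n → ι) (i : Fin n) :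
    ∃ E : ArithExpr ι, ∀ x : ι → ℝ, (∀ j, 0 < x (a j)) → (∀ j, x (a j) < 1) →
      ∃ t ≤ 5 * n + 3, Evaluates x E (closedFormFactor (fun j => x (a j)) i) t := by
  obtain ⟨E, hE⟩ := exists_program_prod (Finset.Ioi i) (fun j : Fin n => ArithExpr.div
    (ArithExpr.sub (ArithExpr.input (a j)) (ArithExpr.input (a i)))
    (ArithExpr.sub ArithExpr.one
      (ArithExpr.mul (ArithExpr.input (a i)) (ArithExpr.input (a j))))) 4
  refine ⟨ArithExpr.mul E (ArithExpr.div ArithExpr.one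
    (ArithExpr.sub ArithExpr.one (ArithExpr.input (a i)))), fun x h0 h1 => ?_⟩
  obtain ⟨t, ht, h⟩ := hE x
    (fun j => (x (a j) - x (a i)) / (1 - x (a i) * x (a j))) fun j _ =>
      ⟨_, le_rfl, Evaluates.div (Evaluates.sub (Evaluates.input _) (Evaluates.input _))
        (Evaluates.sub Evaluates.one (Evaluates.mul (Evaluates.input _) (Evaluates.input _)))
        (sub_pos.2 (mul_lt_one_of_nonneg_of_lt_one_left (h0 i).le (h1 i) (h1 j).le)).ne'⟩
  refine ⟨_, ?_, Evaluates.mul h (Evaluates.div Evaluates.one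
    (Evaluates.sub Evaluates.one (Evaluates.input _)) (sub_pos.2 (h1 i)).ne')⟩
  have hcard : (Finset.Ioi i).card ≤ n := (Finset.card_le_univ _).trans (by simp)
  omega

lemma exists_program_infiniteDetSum (n : ℕ) :
    ∃ e : ArithExpr (Fin n), ∀ lam : Fin n → ℝ,
      StrictMono lam → (∀ i, 0 < lam i) → (∀ i, lam i < 1) →
        ∃ t : ℕ, t ≤ 11 * n ^ 2 ∧ Evaluates lam e (infiniteDetSum lam) t := by
  choose e he using fun i : Fin n => exists_program_closedFormFactor (fun j : Fin n => j) i
  obtain ⟨E, hE⟩ := exists_program_prod Finset.univ e (5 * n + 3)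
  refine ⟨E, fun lam hmono h0 h1 => ?_⟩
  obtain ⟨t, ht, h⟩ := hE lam (closedFormFactor lam) fun i _ => he i lam h0 h1
  refine ⟨t, ht.trans ?_, ?_⟩
  · rw [Finset.card_univ, Fintype.card_fin]
    nlinarith [Nat.le_self_pow two_ne_zero n]
  · rwa [infiniteDetSum_eq_closedForm lam hmono.injective h0 h1, closedForm_eq_prod_factor]

lemma exists_program_volume (n : ℕ) :
    ∃ e : ArithExpr (Fin n ⊕ Fin n), ∀ lam β : Fin n → ℝ,
      StrictMono lam → (∀ i, 0 < lam i) → (∀ i, lam i < 1) →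
        ∃ t : ℕ, t ≤ 11 * n ^ 2 ∧
          Evaluates (Sum.elim lam β) e
            (volume (infiniteZonotope (Matrix.diagonal lam) β)).toReal t := by
  choose e he using fun i : Fin n =>
    exists_program_closedFormFactor (fun j : Fin n => (Sum.inl j : Fin n ⊕ Fin n)) i
  obtain ⟨E, hE⟩ := exists_program_prod Finset.univ
    (fun i => ArithExpr.mul (ArithExpr.abs (ArithExpr.input (Sum.inr i))) (e i)) (5 * n + 5)
  refine ⟨E, fun lam β hmono h0 h1 => ?_⟩
  obtain ⟨t, ht, h⟩ := hE (Sum.elim lam β) (fun i => |β i| * closedFormFactor lam i) fun i _ => by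
    obtain ⟨s, hs, h⟩ := he i (Sum.elim lam β) h0 h1
    exact ⟨_, by omega, Evaluates.mul (Evaluates.abs (Evaluates.input (Sum.inr i))) h⟩
  refine ⟨t, ht.trans ?_, ?_⟩
  · rw [Finset.card_univ, Fintype.card_fin]
    nlinarith [Nat.le_self_pow two_ne_zero n]
  · rw [volume_infiniteZonotope, absMinorSum_ctrlCol (W := 1) hmono h0 h1 β (by simp) (by simp),
      ENNReal.toReal_ofReal]
    · rw [Finset.prod_mul_distrib, ← closedForm_eq_prod_factor, ← Finset.abs_prod] at h
      simpa using h
    · have := closedForm_nonneg hmono h0 h1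
      positivity

theorem theorem3 :
    -- the closed form of the infinite sum and of the volume of the infinite-time zonotope
    (∀ (n : ℕ) (A : Matrix (Fin n) (Fin n) ℝ) (lam : Fin n → ℝ),
      (∀ i, Module.End.HasEigenvalue (Matrix.toLin' A) (lam i)) →
      StrictMono lam → (∀ i, 0 < lam i) → (∀ i, lam i < 1) →
        Summable (fun k : Fin n ↪o ℕ => quasiVandermonde lam k) ∧
        infiniteDetSum lam = closedForm lam ∧
        (∃ W : Matrix (Fin n) (Fin n) ℝ, IsUnit W.det ∧ W * A * W⁻¹ = Matrix.diagonal lam) ∧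
        ∀ (B : Fin n → ℝ) (W : Matrix (Fin n) (Fin n) ℝ),
          IsUnit W.det → W * A * W⁻¹ = Matrix.diagonal lam →
            volume (infiniteZonotope A B) =
              ENNReal.ofReal (|W.det|⁻¹ * (|∏ i, (W.mulVec B) i| * closedForm lam)) ∧
            Tendsto (fun N : ℕ => volume (finiteZonotope A B N)) atTop
              (𝓝 (ENNReal.ofReal (|W.det|⁻¹ * (|∏ i, (W.mulVec B) i| * closedForm lam))))) ∧
    -- the number of arithmetic operations depends on the dimension only
    (∃ C : ℕ, ∀ n : ℕ,
      (∃ e : ArithExpr (Fin n), ∀ lam : Fin n → ℝ,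
        StrictMono lam → (∀ i, 0 < lam i) → (∀ i, lam i < 1) →
          ∃ t : ℕ, t ≤ C * n ^ 2 ∧ Evaluates lam e (infiniteDetSum lam) t) ∧
      (∃ e : ArithExpr (Fin n ⊕ Fin n), ∀ lam β : Fin n → ℝ,
        StrictMono lam → (∀ i, 0 < lam i) → (∀ i, lam i < 1) →
          ∃ t : ℕ, t ≤ C * n ^ 2 ∧
            Evaluates (Sum.elim lam β) e
              (volume (infiniteZonotope (Matrix.diagonal lam) β)).toReal t)) := by
  refine ⟨fun n A lam heig hmono h0 h1 => ⟨?_, ?_, ?_, fun B W hW hA => ⟨?_, ?_⟩⟩, 11,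
    fun n => ⟨exists_program_infiniteDetSum n, exists_program_volume n⟩⟩
  · exact summable_quasiVandermonde lam (fun i => (h0 i).le) h1
  · exact infiniteDetSum_eq_closedForm lam hmono.injective h0 h1
  · exact exists_conj_eq_diagonal A lam heig hmono.injective
  · rw [volume_infiniteZonotope, absMinorSum_ctrlCol hmono h0 h1 B hW hA]
  · simp only [finiteZonotope_eq_segmentSum]
    rw [← absMinorSum_ctrlCol hmono h0 h1 B hW hA]
    exact tendsto_volume_segmentSum _
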